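/- Let $G=\mathrm{SU}(3)$ and let $K=\mathrm S(\mathrm U(2)\times\mathrm U(1))\subset G$ be the subgroup of block diagonal matrices. For $g\in G$ let $A(g)$ denote the left upper $2\times2$ block of $g$, and put $\mathcal A=\{g\in G:\det A(g)\neq0\}$, which is also the set of $g\in G$ with $g_{33}\ne 0$. Let $n\in\mathbb Z$, $\ell\in\mathbb Z_{\ge0}$, and for invertible $A\in \mathrm{GL}(2,\mathbb C)$ let $\pi(A)=(\det A)^n\,A^\ell$, where $A^\ell$ is the $\ell$-th symmetric power of $A$, acting on a space $V$ identified with the $\ell$-th symmetric power of $\mathbb C^2$; write $\pi(k)=\pi(A(k))$ for $k\in K$. Let $v_i=e_1^{\ell-i}e_2^i$ $(0\le i\le\ell)$ be the corresponding basis of $V$, where $e_1,e_2$ is the canonical basis of $\mathbb C^2$. Equip $V$ with any inner product for which $\pi(k)$ is unitary for all $k\in K$, and let $T^*$ denote the adjoint of $T\in\mathrm{End}(V)$. Let $dg$ be the Haar measure on $G$ with $\int_G dg=1$. Let $\Phi,\Psi:G\to\mathrm{End}(V)$ be continuous functions such that $\Phi(k_1gk_2)=\pi(k_1)\Phi(g)\pi(k_2)$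 and $\Psi(k_1gk_2)=\pi(k_1)\Psi(g)\pi(k_2)$ for all $g\in G$ and $k_1,k_2\in K$. On $\mathcal A$ put $\Phi_\pi(g)=\pi(A(g))$ and write $\Phi=H\Phi_\pi$, $\Psi=F\Phi_\pi$, that is, $H(g)=\Phi(g)\Phi_\pi(g)^{-1}$ and $F(g)=\Psi(g)\Phi_\pi(g)^{-1}$. Then, for every $r\ge0$, the operators $H(g)$ and $F(g)$ do not depend on the choice of $g\in\mathcal A$ with $(g_{13}/g_{33},\,g_{23}/g_{33})=(r,0)$, and they are diagonal in the basis $(v_i)$: there are scalars $h_i(r),f_i(r)\in\mathbb C$ with $$H(g)v_i=h_i(r)v_i,\qquad F(g)v_i=f_i(r)v_i\qquad(0\le i\le\ell)$$ for all such $g$. Moreover $g\mapsto\mathrm{tr}(\Phi(g)\Psi(g)^*)$ is integrable on $G$, each integrand on the right below is integrable on $(0,\infty)$, and $$\int_G \mathrm{tr}\big(\Phi(g)\Psi(g)^*\big)\,dg=4\sum_{i=0}^{\ell}\int_0^\infty r^3(1+r^2)^{-(n+\ell+3-i)}\,h_i(r)\,\overline{f_i(r)}\,dr .$$ -/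

import Mathlib

open MeasureTheory MvPolynomial
open scoped ComplexConjugate InnerProductSpace

noncomputable section

namespace SphericalSU3

/-- The group `G = SU(3)`, with the subspace topology of the complex `3 × 3` matrices. -/
abbrev G : Type := Matrix.specialUnitaryGroup (Fin 3) ℂ

/-- The underlying `3 × 3` matrix of an element of `SU(3)`. -/
abbrev mat (g : G) : Matrix (Fin 3) (Fin 3) ℂ := g.1

/-- The subgroup `K = S(U(2) × U(1))` of the block diagonal matrices in `SU(3)`. -/
def K : Subgroup G where
  carrier := {g | mat g 0 2 = 0 ∧ mat g 1 2 = 0 ∧ mat g 2 0 = 0 ∧ mat g 2 1 = 0}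
  one_mem' := by simp [mat]
  mul_mem' := by
    rintro a b ⟨h1, h2, h3, h4⟩ ⟨h5, h6, h7, h8⟩
    simp_all [mat, Matrix.mul_apply, Fin.sum_univ_three]
  inv_mem' := by
    rintro a ⟨h1, h2, h3, h4⟩
    have key : ∀ i j, mat a⁻¹ i j = star (mat a j i) := fun i j => rfl
    simp_all

/-- The left upper `2 × 2` block `A(g)`. -/
def blockA (g : G) : Matrix (Fin 2) (Fin 2) ℂ :=
  !![mat g 0 0, mat g 0 1; mat g 1 0, mat g 1 1]

/-- The open dense set `𝒜 = {g ∈ G : det A(g) ≠ 0}`. -/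
def openCell : Set G := {g | (blockA g).det ≠ 0}

/-- The `ℓ`-th symmetric power of `ℂ²`: the homogeneous polynomials of degree `ℓ` in the
two basis vectors `e₁ = X 0` and `e₂ = X 1`. -/
abbrev SymPow (ℓ : ℕ) : Submodule ℂ (MvPolynomial (Fin 2) ℂ) := homogeneousSubmodule (Fin 2) ℂ ℓ

/-- The algebra endomorphism of the symmetric algebra of `ℂ²` that extends the linear map `A`
of `ℂ²`, i.e. `e_j ↦ ∑ i, A i j e_i`. -/
def symAlg (A : Matrix (Fin 2) (Fin 2) ℂ) : MvPolynomial (Fin 2) ℂ →ₐ[ℂ] MvPolynomial (Fin 2) ℂ :=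
  aeval fun j => ∑ i, C (A i j) * X i

theorem symAlg_mem (ℓ : ℕ) (A : Matrix (Fin 2) (Fin 2) ℂ) (p : MvPolynomial (Fin 2) ℂ)
    (hp : p ∈ SymPow ℓ) : (symAlg A).toLinearMap p ∈ SymPow ℓ := by
  have h : ∀ j, IsHomogeneous (∑ i, C (A i j) * X i : MvPolynomial (Fin 2) ℂ) 1 := by
    intro j
    refine IsHomogeneous.sum _ _ _ fun i _ => ?_
    have h1 := (isHomogeneous_C (Fin 2) (A i j)).mul (isHomogeneous_X ℂ i)
    rwa [zero_add] at h1
  have h2 := IsHomogeneous.aeval ((mem_homogeneousSubmodule ℓ p).1 hp)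
    (fun j => ∑ i, C (A i j) * X i) h
  rw [one_mul] at h2
  exact (mem_homogeneousSubmodule ℓ _).2 h2

/-- The `ℓ`-th symmetric power `A^ℓ` of a `2 × 2` matrix `A`. -/
def symPow (ℓ : ℕ) (A : Matrix (Fin 2) (Fin 2) ℂ) : Module.End ℂ (SymPow ℓ) :=
  (symAlg A).toLinearMap.restrict (symAlg_mem ℓ A)

/-- `π_{n,ℓ}(A) = (det A)^n A^ℓ`; for `det A ≠ 0` this is the holomorphic representation of
`GL(2, ℂ)` and, restricted to `U(2) ≃ K`, the irreducible representation of class `(n, ℓ)`. -/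
def stdRep (n : ℤ) (ℓ : ℕ) (A : Matrix (Fin 2) (Fin 2) ℂ) : Module.End ℂ (SymPow ℓ) :=
  A.det ^ n • symPow ℓ A

/-- The basis vector `e₁^(ℓ-i) e₂^i` of the symmetric power. -/
def stdVec (ℓ : ℕ) (i : Fin (ℓ + 1)) : SymPow ℓ :=
  ⟨X 0 ^ (ℓ - (i : ℕ)) * X 1 ^ (i : ℕ), by
    have h := ((isHomogeneous_X ℂ (0 : Fin 2)).pow (ℓ - (i : ℕ))).mul
      ((isHomogeneous_X ℂ (1 : Fin 2)).pow (i : ℕ))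
    have hi : 1 * (ℓ - (i : ℕ)) + 1 * (i : ℕ) = ℓ := by omega
    rw [hi] at h
    exact h⟩

/-- The coefficient of `e₁^(ℓ-i) e₂^i` in an element of the symmetric power. -/
def stdCoord (ℓ : ℕ) (i : Fin (ℓ + 1)) (p : SymPow ℓ) : ℂ :=
  coeff (Finsupp.single 0 (ℓ - (i : ℕ)) + Finsupp.single 1 (i : ℕ)) (p : MvPolynomial (Fin 2) ℂ)

/-- The element of `SU(3)` that moves the point `(0,0,1)` of the projective plane to `(r,0,1)`:
the matrix `!![c, 0, s; 0, 1, 0; -s, 0, c]` with `c = (1+r²)^(-1/2)` and `s = r c`. -/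
def radial (r : ℝ) : G :=
  ⟨!![(((√(1 + r ^ 2))⁻¹ : ℝ) : ℂ), 0, ((r * (√(1 + r ^ 2))⁻¹ : ℝ) : ℂ);
      0, 1, 0;
      -((r * (√(1 + r ^ 2))⁻¹ : ℝ) : ℂ), 0, (((√(1 + r ^ 2))⁻¹ : ℝ) : ℂ)], by
    have hc : (√(1 + r ^ 2))⁻¹ * (√(1 + r ^ 2))⁻¹ * (1 + r ^ 2) = 1 := by
      have h : 0 < 1 + r ^ 2 := by positivity
      rw [← mul_inv, Real.mul_self_sqrt h.le, inv_mul_cancel₀ h.ne']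
    generalize (√(1 + r ^ 2))⁻¹ = c at hc
    have hC : (c : ℂ) * c * (1 + (r : ℂ) ^ 2) = 1 := by exact_mod_cast hc
    rw [Matrix.mem_specialUnitaryGroup_iff, Matrix.mem_unitaryGroup_iff]
    constructor
    · ext i j
      fin_cases i <;> fin_cases j <;>
        simp [Matrix.mul_apply, Fin.sum_univ_three, Matrix.star_apply] <;>
        first
          | linear_combination hC
          | ring
    · simp [Matrix.det_fin_three]
      linear_combination hC⟩

section Representation

variable {V : Type*} [NormedAddCommGroup V] [InnerProductSpace ℂ V] {ℓ : ℕ}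

/-- The representation `π` of class `(n, ℓ)` on a space `V` that is identified with the
symmetric power by `e`, evaluated at a `2 × 2` matrix. -/
def rep (n : ℤ) (e : SymPow ℓ ≃ₗ[ℂ] V) (A : Matrix (Fin 2) (Fin 2) ℂ) : Module.End ℂ V :=
  e.conj (stdRep n ℓ A)

/-- The inner product of `V` makes `π(k)` unitary for every `k ∈ K`. -/
def IsUnitaryOnK (n : ℤ) (e : SymPow ℓ ≃ₗ[ℂ] V) : Prop :=
  ∀ k ∈ K, ∀ x y : V, ⟪rep n e (blockA k) x, rep n e (blockA k) y⟫_ℂ = ⟪x, y⟫_ℂ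

/-- `Φ(k₁ g k₂) = π(k₁) Φ(g) π(k₂)` for all `g ∈ G`, `k₁, k₂ ∈ K`. -/
def IsBiequivariant (n : ℤ) (e : SymPow ℓ ≃ₗ[ℂ] V) (Φ : C(G, V →L[ℂ] V)) : Prop :=
  ∀ k₁ ∈ K, ∀ k₂ ∈ K, ∀ g : G, ∀ x : V,
    Φ (k₁ * g * k₂) x = rep n e (blockA k₁) (Φ g (rep n e (blockA k₂) x))

/-- The function `Φ_π(g) = π(A(g))` on `𝒜`. -/
def PhiPi (n : ℤ) (e : SymPow ℓ ≃ₗ[ℂ] V) (g : G) : Module.End ℂ V := rep n e (blockA g)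

/-- The function `H(g) = Φ(g) Φ_π(g)⁻¹` on `𝒜`. -/
def quot (n : ℤ) (e : SymPow ℓ ≃ₗ[ℂ] V) (Φ : C(G, V →L[ℂ] V)) (g : G) : Module.End ℂ V :=
  (Φ g).toLinearMap ∘ₗ Ring.inverse (PhiPi n e g)

/-- The basis vector `v_i` of `V`. -/
def vec (e : SymPow ℓ ≃ₗ[ℂ] V) (i : Fin (ℓ + 1)) : V := e (stdVec ℓ i)

/-- The scalar function `h_i(r)`: the `i`-th diagonal entry of `H̃(r) = H(r, 0)` with respect to
the basis `v_0, …, v_ℓ`. -/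
def diagEntry (n : ℤ) (e : SymPow ℓ ≃ₗ[ℂ] V) (Φ : C(G, V →L[ℂ] V)) (i : Fin (ℓ + 1)) (r : ℝ) : ℂ :=
  stdCoord ℓ i (e.symm (quot n e Φ (radial r) (vec e i)))

/-- The function `g ↦ tr (Φ(g) Ψ(g)^*)`. -/
def trMulAdj [FiniteDimensional ℂ V] (Φ Ψ : C(G, V →L[ℂ] V)) (g : G) : ℂ :=
  LinearMap.trace ℂ V ((Φ g).toLinearMap ∘ₗ LinearMap.adjoint (Ψ g).toLinearMap)

end Representation

end SphericalSU3

end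

open MeasureTheory MvPolynomial
open scoped ComplexConjugate InnerProductSpace

noncomputable section

namespace SphericalSU3

/-! ### Symmetric powers of `2 × 2` matrices -/

/-! Unitarity of `π` on `K` and cyclicity of the trace make `tr(Φ(g)Ψ(g)*)` bi-invariant under `K`.
By the decomposition `G = K·cartan·K` it is a function of `t = |g₃₃|²` alone, so the integral over
`G` is an integral against the law of `|g₃₃|²`.

On a radial element, `Φ` commutes with `π` of a torus element that separates the weights, hence is
diagonal in the `v_i` (`IsBiequivariant.apply_vec`). The `v_i` are orthogonal for the same reason,
so the trace is a sum of products of diagonal entries (`trMulAdj_cartan`).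

The law of `|g₃₃|²` has density `2(1-t)` on `[0,1]`. Its moments come from integrating
`|(g⁻¹v)₃|^(2k) e^(-|v|²)` over `G × ℂ³` in both orders (`integral_norm_mat_sq_pow`); Weierstrass
approximation extends the result to continuous functions.

Under `t = 1/(1+r²)` the density becomes `4r³(1+r²)⁻³ dr`. Since `Φ_π` acts on `v_i` at the radial
point by `(1+r²)^(-(n+ℓ-i)/2)`, replacing the entries of `Φ` and `Ψ` by `h_i` and `f_i` contributes
the remaining power of `1+r²`. -/

theorem symAlg_mul (A B : Matrix (Fin 2) (Fin 2) ℂ) :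
    symAlg (A * B) = (symAlg A).comp (symAlg B) := by
  refine algHom_ext fun j => ?_
  simp only [symAlg, aeval_X, AlgHom.comp_apply, map_mul, algHom_C, Fin.sum_univ_two,
    Matrix.mul_apply, map_add, algebraMap_eq]
  ring

theorem symAlg_diagonal_X (a b : ℂ) (j : Fin 2) :
    symAlg !![a, 0; 0, b] (X j) = C (![a, b] j) * X j := by
  fin_cases j <;> simp [symAlg]

theorem symAlg_one : symAlg 1 = AlgHom.id ℂ _ := by
  refine algHom_ext fun j => ?_
  fin_cases j <;> simp [symAlg]

theorem symPow_mul (ℓ : ℕ) (A B : Matrix (Fin 2) (Fin 2) ℂ) :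
    symPow ℓ (A * B) = symPow ℓ A * symPow ℓ B := by
  ext p : 2
  simp [symPow, LinearMap.restrict_apply, symAlg_mul]

theorem symPow_one (ℓ : ℕ) : symPow ℓ 1 = 1 := by
  ext p : 2
  simp [symPow, LinearMap.restrict_apply, symAlg_one]

theorem stdRep_mul (n : ℤ) (ℓ : ℕ) (A B : Matrix (Fin 2) (Fin 2) ℂ) :
    stdRep n ℓ (A * B) = stdRep n ℓ A * stdRep n ℓ B := by
  simp [stdRep, symPow_mul, mul_zpow, smul_smul, mul_comm]

theorem stdRep_one (n : ℤ) (ℓ : ℕ) : stdRep n ℓ 1 = 1 := by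
  simp [stdRep, symPow_one]

theorem stdRep_diagonal_stdVec (n : ℤ) (ℓ : ℕ) (a b : ℂ) (i : Fin (ℓ + 1)) :
    stdRep n ℓ !![a, 0; 0, b] (stdVec ℓ i) =
      ((a * b) ^ n * (a ^ (ℓ - (i : ℕ)) * b ^ (i : ℕ))) • stdVec ℓ i := by
  ext1
  simp only [stdRep, symPow, LinearMap.smul_apply, SetLike.val_smul, LinearMap.restrict_apply,
    stdVec, AlgHom.toLinearMap_apply, map_mul, map_pow, symAlg_diagonal_X, Matrix.det_fin_two_of,
    mul_zero, sub_zero, mul_pow, mul_smul]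
  congr 1
  simp only [Matrix.cons_val_zero, Matrix.cons_val_one, smul_eq_C_mul, map_pow]
  ring

theorem stdCoord_stdVec (ℓ : ℕ) (i j : Fin (ℓ + 1)) :
    stdCoord ℓ i (stdVec ℓ j) = if j = i then 1 else 0 := by
  simp only [stdCoord, stdVec, X_pow_eq_monomial, monomial_mul, mul_one, coeff_monomial]
  refine if_congr ⟨fun h => ?_, fun h => by rw [h]⟩ rfl rfl
  have := DFunLike.congr_fun h 1
  simp at this
  exact Fin.ext this

/-- A monomial of degree `ℓ` in two variables is determined by its exponent in `X 1`. -/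
theorem eq_zero_of_stdCoord (ℓ : ℕ) (p : SymPow ℓ) (h : ∀ i, stdCoord ℓ i p = 0) : p = 0 := by
  ext d
  simp only [ZeroMemClass.coe_zero, coeff_zero]
  by_contra hd
  have hdeg := (mem_homogeneousSubmodule ℓ _).1 p.2 hd
  have hsum : d 0 + d 1 = ℓ := by
    simpa [Finsupp.weight_apply, Finsupp.sum_fintype] using hdeg
  apply hd
  have hd' : d = Finsupp.single 0 (ℓ - d 1) + Finsupp.single 1 (d 1) := by
    ext j
    fin_cases j
    · simp; omega
    · simp
  have := h ⟨d 1, by omega⟩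
  rw [stdCoord, ← hd'] at this
  exact this

/-- The coordinate isomorphism of the symmetric power. -/
def stdEquiv (ℓ : ℕ) : SymPow ℓ ≃ₗ[ℂ] (Fin (ℓ + 1) → ℂ) :=
  LinearEquiv.ofBijective
    { toFun := fun p i => stdCoord ℓ i p
      map_add' := fun p q => by ext; simp [stdCoord]
      map_smul' := fun c p => by ext; simp [stdCoord] }
    ⟨(injective_iff_map_eq_zero _).2 fun p hp => eq_zero_of_stdCoord ℓ p (congrFun hp),
      fun c => ⟨∑ j, c j • stdVec ℓ j, by
        rw [map_sum]
        ext i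
        simp only [map_smul, Finset.sum_apply, Pi.smul_apply]
        simp [stdCoord_stdVec]⟩⟩

@[simp] theorem stdEquiv_apply (ℓ : ℕ) (p : SymPow ℓ) (i : Fin (ℓ + 1)) :
    stdEquiv ℓ p i = stdCoord ℓ i p := rfl

/-! ### The representation on `V` and its weight basis -/

section Representation

variable {V : Type*} [NormedAddCommGroup V] [InnerProductSpace ℂ V] {ℓ : ℕ}

/-- The vectors `v_i` form a basis of `V`. -/
def vecBasis (e : SymPow ℓ ≃ₗ[ℂ] V) : Module.Basis (Fin (ℓ + 1)) ℂ V :=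
  Module.Basis.ofEquivFun (e.symm.trans (stdEquiv ℓ))

theorem vecBasis_repr (e : SymPow ℓ ≃ₗ[ℂ] V) (x : V) (i : Fin (ℓ + 1)) :
    (vecBasis e).repr x i = stdCoord ℓ i (e.symm x) := rfl

theorem vecBasis_apply (e : SymPow ℓ ≃ₗ[ℂ] V) (i : Fin (ℓ + 1)) : vecBasis e i = vec e i := by
  apply (vecBasis e).repr.injective
  ext j
  rw [Module.Basis.repr_self, Finsupp.single_apply, vecBasis_repr]
  simp [vec, stdCoord_stdVec]

theorem vec_ne_zero (e : SymPow ℓ ≃ₗ[ℂ] V) (i : Fin (ℓ + 1)) : vec e i ≠ 0 := by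
  rw [← vecBasis_apply]
  exact (vecBasis e).ne_zero i

theorem rep_mul (n : ℤ) (e : SymPow ℓ ≃ₗ[ℂ] V) (A B : Matrix (Fin 2) (Fin 2) ℂ) :
    rep n e (A * B) = rep n e A * rep n e B := by
  rw [rep, stdRep_mul]
  exact LinearEquiv.conj_comp e _ _

theorem rep_one (n : ℤ) (e : SymPow ℓ ≃ₗ[ℂ] V) : rep n e 1 = 1 := by
  rw [rep, stdRep_one]
  exact LinearEquiv.conj_id e

theorem rep_mul_rep_inv (n : ℤ) (e : SymPow ℓ ≃ₗ[ℂ] V) {A : Matrix (Fin 2) (Fin 2) ℂ}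
    (hA : A.det ≠ 0) : rep n e A * rep n e A⁻¹ = 1 := by
  rw [← rep_mul, Matrix.mul_nonsing_inv _ (isUnit_iff_ne_zero.2 hA), rep_one]

theorem rep_inv_mul_rep (n : ℤ) (e : SymPow ℓ ≃ₗ[ℂ] V) {A : Matrix (Fin 2) (Fin 2) ℂ}
    (hA : A.det ≠ 0) : rep n e A⁻¹ * rep n e A = 1 := by
  rw [← rep_mul, Matrix.nonsing_inv_mul _ (isUnit_iff_ne_zero.2 hA), rep_one]

theorem ringInverse_rep (n : ℤ) (e : SymPow ℓ ≃ₗ[ℂ] V) {A : Matrix (Fin 2) (Fin 2) ℂ}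
    (hA : A.det ≠ 0) : Ring.inverse (rep n e A) = rep n e A⁻¹ := by
  exact Ring.inverse_unit
    (⟨rep n e A, rep n e A⁻¹, rep_mul_rep_inv n e hA, rep_inv_mul_rep n e hA⟩ : (Module.End ℂ V)ˣ)

theorem rep_diagonal_vec (n : ℤ) (e : SymPow ℓ ≃ₗ[ℂ] V) (a b : ℂ) (i : Fin (ℓ + 1)) :
    rep n e !![a, 0; 0, b] (vec e i) =
      ((a * b) ^ n * (a ^ (ℓ - (i : ℕ)) * b ^ (i : ℕ))) • vec e i := by
  simp [rep, vec, LinearEquiv.conj_apply, stdRep_diagonal_stdVec]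

end Representation

/-! ### The subgroup `K` -/

theorem mat_mul (g h : G) : mat (g * h) = mat g * mat h := rfl

theorem mat_inv (g : G) (i j : Fin 3) : mat g⁻¹ i j = conj (mat g j i) := rfl

theorem conj_mul_col (g : G) (i j : Fin 3) :
    ∑ k, conj (mat g k i) * mat g k j = if i = j then 1 else 0 := by
  have h := congrFun₂ (congrArg mat (inv_mul_cancel g)) i j
  rw [mat_mul, Matrix.mul_apply] at h
  simp only [mat_inv] at h
  rw [h]
  exact Matrix.one_apply

theorem row_mul_conj (g : G) (i j : Fin 3) :
    ∑ k, mat g i k * conj (mat g j k) = if i = j then 1 else 0 := by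
  have h := congrFun₂ (congrArg mat (mul_inv_cancel g)) i j
  rw [mat_mul, Matrix.mul_apply] at h
  simp only [mat_inv] at h
  rw [h]
  exact Matrix.one_apply

theorem normSq_col (g : G) :
    ‖mat g 0 2‖ ^ 2 + ‖mat g 1 2‖ ^ 2 + ‖mat g 2 2‖ ^ 2 = 1 := by
  have h := conj_mul_col g 2 2
  simp only [Fin.sum_univ_three, Complex.conj_mul', if_true] at h
  exact_mod_cast h

theorem normSq_row (g : G) :
    ‖mat g 2 0‖ ^ 2 + ‖mat g 2 1‖ ^ 2 + ‖mat g 2 2‖ ^ 2 = 1 := by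
  have h := row_mul_conj g 2 2
  simp only [Fin.sum_univ_three, Complex.mul_conj', if_true] at h
  exact_mod_cast h

/-- The last column has norm one, so `|g₃₃| = 1`; the last row, also of norm one, then has no room
for other entries. -/
theorem mem_K_of_col {g : G} (h0 : mat g 0 2 = 0) (h1 : mat g 1 2 = 0) : g ∈ K := by
  have hc := normSq_col g
  have hr := normSq_row g
  rw [h0, h1] at hc
  simp only [norm_zero] at hc
  have hs : ‖mat g 2 0‖ ^ 2 + ‖mat g 2 1‖ ^ 2 = 0 := by linarith
  have ha : ‖mat g 2 0‖ = 0 := by nlinarith [sq_nonneg ‖mat g 2 0‖, sq_nonneg ‖mat g 2 1‖]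
  have hb : ‖mat g 2 1‖ = 0 := by nlinarith [sq_nonneg ‖mat g 2 0‖, sq_nonneg ‖mat g 2 1‖]
  exact ⟨h0, h1, norm_eq_zero.1 ha, norm_eq_zero.1 hb⟩

/-- The inverse of `g` is both its conjugate transpose and, as `det g = 1`, its adjugate. Hence `𝒜`
is also the set where `g₃₃ ≠ 0`. -/
theorem conj_mat_two_two (g : G) : conj (mat g 2 2) = (blockA g).det := by
  have h1 : mat g * (mat g).adjugate = 1 := by
    rw [Matrix.mul_adjugate, (Matrix.mem_specialUnitaryGroup_iff.1 g.2).2, one_smul]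
  have h2 : mat g⁻¹ * mat g = 1 := congrArg mat (inv_mul_cancel g)
  have h3 : mat g⁻¹ = (mat g).adjugate := left_inv_eq_right_inv h2 h1
  have h4 := congrFun₂ h3 2 2
  rw [mat_inv, Matrix.adjugate_fin_three] at h4
  rw [h4, blockA, Matrix.det_fin_two_of]
  simp

theorem blockA_mul_of_mem_right (g : G) {k : G} (hk : k ∈ K) :
    blockA (g * k) = blockA g * blockA k := by
  obtain ⟨-, -, h3, h4⟩ := hk
  ext i j
  fin_cases i <;> fin_cases j <;>
    simp [blockA, Matrix.mul_apply, Fin.sum_univ_three, h3, h4]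

theorem det_blockA_ne_zero_of_mem {k : G} (hk : k ∈ K) : (blockA k).det ≠ 0 := by
  have h := normSq_col k
  rw [hk.1, hk.2.1] at h
  rw [← conj_mat_two_two]
  intro h0
  rw [map_eq_zero] at h0
  simp [h0] at h

/-- The element `h⁻¹g` fixes the third basis vector. -/
theorem mem_K_of_same_col {g h : G} (hc : ∀ i, mat g i 2 = mat h i 2) : h⁻¹ * g ∈ K := by
  have key : ∀ i, mat (h⁻¹ * g) i 2 = if i = 2 then 1 else 0 := by
    intro i
    rw [mat_mul, Matrix.mul_apply]
    simp only [mat_inv, hc]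
    exact conj_mul_col h i 2
  exact mem_K_of_col (by simp [key]) (by simp [key])

/-- The element of `K` with lower right entry `d` and first column `(b₁, b₂, 0)`. -/
def blockElt (d b₁ b₂ : ℂ) (hd : d * conj d = 1) (hb : b₁ * conj b₁ + b₂ * conj b₂ = 1) : G :=
  ⟨!![b₁, -(conj d * conj b₂), 0; b₂, conj d * conj b₁, 0; 0, 0, d], by
    rw [Matrix.mem_specialUnitaryGroup_iff, Matrix.mem_unitaryGroup_iff']
    constructor
    · ext i j
      fin_cases i <;> fin_cases j <;>
        simp [Matrix.mul_apply, Fin.sum_univ_three, Matrix.star_apply] <;>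
        first
          | ring1
          | linear_combination hd
          | linear_combination hb
          | linear_combination d * conj d * hb + hd
    · simp [Matrix.det_fin_three]
      linear_combination d * conj d * hb + hd⟩

theorem mat_blockElt (d b₁ b₂ : ℂ) (hd : d * conj d = 1)
    (hb : b₁ * conj b₁ + b₂ * conj b₂ = 1) : mat (blockElt d b₁ b₂ hd hb) =
      !![b₁, -(conj d * conj b₂), 0; b₂, conj d * conj b₁, 0; 0, 0, d] := rfl

theorem blockElt_mem (d b₁ b₂ : ℂ) (hd : d * conj d = 1)
    (hb : b₁ * conj b₁ + b₂ * conj b₂ = 1) : blockElt d b₁ b₂ hd hb ∈ K :=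
  ⟨rfl, rfl, rfl, rfl⟩

/-! ### Radial elements and the Cartan decomposition -/

/-- The truncation of a real number to `[0, 1]`. -/
def clamp (t : ℝ) : ℝ := max 0 (min 1 t)

theorem clamp_nonneg (t : ℝ) : 0 ≤ clamp t := le_max_left _ _

theorem clamp_le_one (t : ℝ) : clamp t ≤ 1 := max_le zero_le_one (min_le_left _ _)

theorem clamp_of_mem {t : ℝ} (h0 : 0 ≤ t) (h1 : t ≤ 1) : clamp t = t := by
  rw [clamp, min_eq_right h1, max_eq_right h0]

theorem continuous_clamp : Continuous clamp := by unfold clamp; fun_prop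

/-- The radial element of `SU(3)` whose lower right entry has square `t`, for `t ∈ [0, 1]`. -/
def cartan (t : ℝ) : G :=
  ⟨!![((√(clamp t) : ℝ) : ℂ), 0, ((√(1 - clamp t) : ℝ) : ℂ);
      0, 1, 0;
      -((√(1 - clamp t) : ℝ) : ℂ), 0, ((√(clamp t) : ℝ) : ℂ)], by
    have h1 := Real.mul_self_sqrt (clamp_nonneg t)
    have h2 := Real.mul_self_sqrt (sub_nonneg.2 (clamp_le_one t))
    generalize √(1 - clamp t) = s at *
    generalize √(clamp t) = c at *
    have hC : (c : ℂ) * c + s * s = 1 := by exact_mod_cast (by linarith : c * c + s * s = 1)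
    rw [Matrix.mem_specialUnitaryGroup_iff, Matrix.mem_unitaryGroup_iff]
    constructor
    · ext i j
      fin_cases i <;> fin_cases j <;>
        simp [Matrix.mul_apply, Fin.sum_univ_three, Matrix.star_apply] <;>
        first
          | linear_combination hC
          | ring
    · simp [Matrix.det_fin_three]
      linear_combination hC⟩

theorem mat_cartan (t : ℝ) : mat (cartan t) =
    !![((√(clamp t) : ℝ) : ℂ), 0, ((√(1 - clamp t) : ℝ) : ℂ);
      0, 1, 0;
      -((√(1 - clamp t) : ℝ) : ℂ), 0, ((√(clamp t) : ℝ) : ℂ)] := rfl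

theorem mat_radial (r : ℝ) : mat (radial r) =
    !![(((√(1 + r ^ 2))⁻¹ : ℝ) : ℂ), 0, ((r * (√(1 + r ^ 2))⁻¹ : ℝ) : ℂ);
      0, 1, 0;
      -((r * (√(1 + r ^ 2))⁻¹ : ℝ) : ℂ), 0, (((√(1 + r ^ 2))⁻¹ : ℝ) : ℂ)] := rfl

/-- The truncation extends the family continuously to all of `ℝ`, so that matrix entries along it
are continuous test functions of `t`. The endpoint `t = 0`, which no `radial r` reaches, is
included. -/
theorem continuous_cartan : Continuous cartan := by
  have h := continuous_clamp
  refine Continuous.subtype_mk ?_ _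
  refine continuous_matrix fun i j => ?_
  fin_cases i <;> fin_cases j <;> simp <;> fun_prop

theorem radial_eq_cartan {r : ℝ} (hr : 0 ≤ r) : radial r = cartan (1 / (1 + r ^ 2)) := by
  have hp : 0 < 1 + r ^ 2 := by positivity
  have hcl : clamp (1 / (1 + r ^ 2)) = (1 + r ^ 2)⁻¹ := by
    rw [one_div]
    exact clamp_of_mem (by positivity) (inv_le_one_of_one_le₀ (by nlinarith [sq_nonneg r]))
  have h1 : √(clamp (1 / (1 + r ^ 2))) = (√(1 + r ^ 2))⁻¹ := by rw [hcl, Real.sqrt_inv]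
  have h2 : √(1 - clamp (1 / (1 + r ^ 2))) = r * (√(1 + r ^ 2))⁻¹ := by
    rw [hcl, show 1 - (1 + r ^ 2)⁻¹ = r ^ 2 * (1 + r ^ 2)⁻¹ by field_simp; ring,
      Real.sqrt_mul (sq_nonneg r), Real.sqrt_sq hr, Real.sqrt_inv]
  refine Subtype.ext ?_
  simp only [radial, cartan, h1, h2]

/-- Every unit vector of `ℂ³` is the last column of an element of `K` times a radial one. -/
theorem exists_mem_K_mul_cartan_col (x y z : ℂ) (h : ‖x‖ ^ 2 + ‖y‖ ^ 2 + ‖z‖ ^ 2 = 1) :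
    ∃ k ∈ K, mat (k * cartan (‖z‖ ^ 2)) 0 2 = x ∧ mat (k * cartan (‖z‖ ^ 2)) 1 2 = y ∧
      mat (k * cartan (‖z‖ ^ 2)) 2 2 = z := by
  have hcl : clamp (‖z‖ ^ 2) = ‖z‖ ^ 2 :=
    clamp_of_mem (by positivity) (by nlinarith [sq_nonneg ‖x‖, sq_nonneg ‖y‖])
  have hc : √(clamp (‖z‖ ^ 2)) = ‖z‖ := by rw [hcl, Real.sqrt_sq (norm_nonneg z)]
  set s := √(1 - clamp (‖z‖ ^ 2)) with hs
  have hs2 : s ^ 2 = ‖x‖ ^ 2 + ‖y‖ ^ 2 := by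
    rw [hs, hcl, Real.sq_sqrt] <;> nlinarith [sq_nonneg ‖x‖, sq_nonneg ‖y‖]
  -- The phase of `z`, with default 1 at `z = 0`.
  obtain ⟨d, hd, hdz⟩ : ∃ d : ℂ, d * conj d = 1 ∧ d * (‖z‖ : ℂ) = z := by
    by_cases hz : z = 0
    · exact ⟨1, by simp, by simp [hz]⟩
    · have hn : (‖z‖ : ℂ) ≠ 0 := by simpa using hz
      refine ⟨z / ‖z‖, ?_, div_mul_cancel₀ _ hn⟩
      rw [map_div₀, Complex.conj_ofReal, div_mul_div_comm, Complex.mul_conj']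
      field_simp
  -- The direction of `(x, y)`, with default `(1, 0)` when both vanish.
  obtain ⟨b₁, b₂, hb, h1, h2⟩ : ∃ b₁ b₂ : ℂ, b₁ * conj b₁ + b₂ * conj b₂ = 1 ∧
      b₁ * (s : ℂ) = x ∧ b₂ * (s : ℂ) = y := by
    by_cases hs0 : s = 0
    · rw [hs0] at hs2
      have hx : ‖x‖ = 0 := by nlinarith [sq_nonneg ‖x‖, sq_nonneg ‖y‖]
      have hy : ‖y‖ = 0 := by nlinarith [sq_nonneg ‖x‖, sq_nonneg ‖y‖]
      exact ⟨1, 0, by simp, by simp [hs0, norm_eq_zero.1 hx], by simp [norm_eq_zero.1 hy]⟩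
    · have hn : (s : ℂ) ≠ 0 := by exact_mod_cast hs0
      refine ⟨x / s, y / s, ?_, div_mul_cancel₀ _ hn, div_mul_cancel₀ _ hn⟩
      rw [map_div₀, map_div₀, Complex.conj_ofReal, div_mul_div_comm, div_mul_div_comm,
        Complex.mul_conj', Complex.mul_conj', ← add_div, div_eq_one_iff_eq (mul_ne_zero hn hn)]
      exact_mod_cast (by nlinarith : ‖x‖ ^ 2 + ‖y‖ ^ 2 = s * s)
  refine ⟨blockElt d b₁ b₂ hd hb, blockElt_mem _ _ _ _ _, ?_, ?_, ?_⟩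
  · rw [mat_mul, Matrix.mul_apply, ← h1]
    simp [mat_blockElt, mat_cartan, Fin.sum_univ_three, hs]
  · rw [mat_mul, Matrix.mul_apply, ← h2]
    simp [mat_blockElt, mat_cartan, Fin.sum_univ_three, hs]
  · rw [mat_mul, Matrix.mul_apply]
    simpa [mat_blockElt, mat_cartan, Fin.sum_univ_three, hc] using hdz

/-- Some `k * cartan t` with `k ∈ K` has the same last column as `g`, so the two differ by a right
factor in `K`. -/
theorem exists_mul_cartan_mul (g : G) :
    ∃ k₁ ∈ K, ∃ k₂ ∈ K, g = k₁ * cartan (‖mat g 2 2‖ ^ 2) * k₂ := by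
  obtain ⟨k, hk, h0, h1, h2⟩ := exists_mem_K_mul_cartan_col _ _ _ (normSq_col g)
  refine ⟨k, hk, (k * cartan (‖mat g 2 2‖ ^ 2))⁻¹ * g, mem_K_of_same_col fun i => ?_, by group⟩
  fin_cases i
  · exact h0.symm
  · exact h1.symm
  · exact h2.symm

/-! ### Biequivariant functions on the radial elements -/

section Representation

variable {V : Type*} [NormedAddCommGroup V] [InnerProductSpace ℂ V] {n : ℤ} {ℓ : ℕ}
  {e : SymPow ℓ ≃ₗ[ℂ] V}

/-- A torus element which separates the weights of `V` and commutes with the radial elements. -/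
theorem exists_separating_torus_element (n : ℤ) (e : SymPow ℓ ≃ₗ[ℂ] V) :
    ∃ k ∈ K, ∃ w : Fin (ℓ + 1) → ℂ, Function.Injective w ∧
      (∀ i, rep n e (blockA k) (vec e i) = w i • vec e i) ∧
      ∀ g : G, mat g 0 1 = 0 → mat g 1 0 = 0 → mat g 1 2 = 0 → mat g 2 1 = 0 → k * g = g * k := by
  -- The element is `diag(u, u⁻², u)`; its equal outer entries make it commute with the `g` in
  -- question. Its weight on `v_i` is a constant times `u^(ℓ-3i)`, and the exponents `3i` with `i ≤
  -- ℓ` lie below `3(ℓ+1)`, so a primitive root of that order separates them.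
  obtain ⟨u, hu⟩ : ∃ u : ℂ, IsPrimitiveRoot u (3 * (ℓ + 1)) :=
    ⟨_, Complex.isPrimitiveRoot_exp _ (by omega)⟩
  have hu0 : u ≠ 0 := hu.ne_zero (by omega)
  have hn : u * conj u = 1 := by
    rw [Complex.mul_conj', hu.norm'_eq_one (by omega)]
    simp
  have hconj : conj u = u⁻¹ := eq_inv_of_mul_eq_one_right hn
  refine ⟨blockElt u u 0 hn (by simpa using hn), blockElt_mem _ _ _ _ _,
    fun i => (u * (conj u * conj u)) ^ n * (u ^ (ℓ - (i : ℕ)) * (conj u * conj u) ^ (i : ℕ)),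
    ?_, ?_, ?_⟩
  · intro i j hij
    have hc : (u * (conj u * conj u)) ^ n ≠ 0 := by
      rw [hconj]
      exact zpow_ne_zero _ (by simp [hu0])
    have hij' := mul_left_cancel₀ hc hij
    have key : ∀ i : Fin (ℓ + 1),
        (u ^ (ℓ - (i : ℕ)) * (conj u * conj u) ^ (i : ℕ)) * u ^ (3 * (i : ℕ)) = u ^ ℓ := by
      intro i
      have h3 : u ^ (3 * (i : ℕ)) = u ^ (i : ℕ) * (u * u) ^ (i : ℕ) := by
        rw [← mul_pow, pow_mul]
        ring
      have h1 : (conj u * conj u) ^ (i : ℕ) * (u * u) ^ (i : ℕ) = 1 := by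
        rw [← mul_pow, show conj u * conj u * (u * u) = (u * conj u) * (u * conj u) by ring, hn]
        simp
      have h2 : u ^ (ℓ - (i : ℕ)) * u ^ (i : ℕ) = u ^ ℓ := by
        rw [← pow_add]
        congr 1
        omega
      rw [h3]
      linear_combination u ^ (ℓ - (i : ℕ)) * u ^ (i : ℕ) * h1 + h2
    have hi := key i
    rw [hij', ← key j] at hi
    have hne : u ^ (ℓ - (j : ℕ)) * (conj u * conj u) ^ (j : ℕ) ≠ 0 := by
      rw [hconj]
      simp [hu0]
    have := hu.pow_inj (by omega) (by omega) (mul_left_cancel₀ hne hi)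
    exact Fin.ext (by omega)
  · intro i
    have hb : blockA (blockElt u u 0 hn (by simpa using hn)) =
        !![u, 0; 0, conj u * conj u] := by
      simp [blockA, mat_blockElt]
    rw [hb, rep_diagonal_vec]
  · intro g h1 h2 h3 h4
    refine Subtype.ext ?_
    change mat (_ * g) = mat (g * _)
    ext i j
    rw [mat_mul, mat_mul, Matrix.mul_apply, Matrix.mul_apply]
    fin_cases i <;> fin_cases j <;>
      simp [Fin.sum_univ_three, mat_blockElt, h1, h2, h3, h4, mul_comm]

theorem blockA_one : blockA 1 = 1 := by
  ext i j
  fin_cases i <;> fin_cases j <;> simp [blockA]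

theorem IsBiequivariant.mul_left {Φ : C(G, V →L[ℂ] V)} (hΦ : IsBiequivariant n e Φ) {k : G}
    (hk : k ∈ K) (g : G) (x : V) : Φ (k * g) x = rep n e (blockA k) (Φ g x) := by
  simpa [blockA_one, rep_one] using hΦ k hk 1 K.one_mem g x

theorem IsBiequivariant.mul_right {Φ : C(G, V →L[ℂ] V)} (hΦ : IsBiequivariant n e Φ) {k : G}
    (hk : k ∈ K) (g : G) (x : V) : Φ (g * k) x = Φ g (rep n e (blockA k) x) := by
  simpa [blockA_one, rep_one] using hΦ 1 K.one_mem k hk g x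

/-- The `i`-th diagonal matrix entry of `Φ g` in the basis `v_0, …, v_ℓ`. -/
def matEntry (e : SymPow ℓ ≃ₗ[ℂ] V) (Φ : C(G, V →L[ℂ] V)) (i : Fin (ℓ + 1)) (g : G) : ℂ :=
  stdCoord ℓ i (e.symm (Φ g (vec e i)))

/-- As `g` commutes with the separating element `k`, `Φ(g)` preserves the eigenspaces of `π(k)`,
which are the lines spanned by the `v_i`. -/
theorem IsBiequivariant.apply_vec {Φ : C(G, V →L[ℂ] V)} (hΦ : IsBiequivariant n e Φ) {g : G}
    (h1 : mat g 0 1 = 0) (h2 : mat g 1 0 = 0) (h3 : mat g 1 2 = 0) (h4 : mat g 2 1 = 0)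
    (i : Fin (ℓ + 1)) : Φ g (vec e i) = matEntry e Φ i g • vec e i := by
  obtain ⟨k, hk, w, hw, hkv, hcomm⟩ := exists_separating_torus_element n e
  have hT : rep n e (blockA k) (Φ g (vec e i)) = w i • Φ g (vec e i) := by
    rw [← hΦ.mul_left hk, hcomm g h1 h2 h3 h4, hΦ.mul_right hk, hkv, map_smul]
  have hco : ∀ x j, (vecBasis e).repr (rep n e (blockA k) x) j = w j * (vecBasis e).repr x j := by
    intro x j
    have hlin : (vecBasis e).coord j ∘ₗ rep n e (blockA k) = w j • (vecBasis e).coord j := by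
      refine (vecBasis e).ext fun m => ?_
      rw [LinearMap.comp_apply, vecBasis_apply, hkv, ← vecBasis_apply]
      by_cases hmj : m = j
      · simp [hmj]
      · simp [hmj]
    exact LinearMap.congr_fun hlin x
  apply (vecBasis e).repr.injective
  ext j
  rw [map_smul, ← vecBasis_apply, Module.Basis.repr_self, Finsupp.smul_apply,
    Finsupp.single_apply, vecBasis_apply]
  by_cases hij : i = j
  · subst hij
    simp [vecBasis_repr, matEntry]
  · have h := hco (Φ g (vec e i)) j
    rw [hT, map_smul, Finsupp.smul_apply, smul_eq_mul] at h
    have h' : (w i - w j) * (vecBasis e).repr (Φ g (vec e i)) j = 0 := by linear_combination h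
    rcases mul_eq_zero.1 h' with h'' | h''
    · exact absurd (hw (sub_eq_zero.1 h'')) hij
    · simp [hij, h'']

/-- Eigenvectors of the unitary operator `π(k)` for distinct eigenvalues are orthogonal. -/
theorem IsUnitaryOnK.inner_vec (he : IsUnitaryOnK n e) {i j : Fin (ℓ + 1)} (hij : i ≠ j) :
    ⟪vec e i, vec e j⟫_ℂ = 0 := by
  obtain ⟨k, hk, w, hw, hkv, -⟩ := exists_separating_torus_element n e
  have h := he k hk (vec e i) (vec e j)
  have h1 := he k hk (vec e i) (vec e i)
  rw [hkv, inner_smul_left, inner_smul_right] at h1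
  rw [hkv, hkv, inner_smul_left, inner_smul_right] at h
  have hii : ⟪vec e i, vec e i⟫_ℂ ≠ 0 := by
    rw [inner_self_ne_zero]
    exact vec_ne_zero e i
  have hwi : conj (w i) * w i = 1 := by
    apply mul_right_cancel₀ hii
    linear_combination h1
  by_contra hne
  have hwj : conj (w i) * w j = 1 := by
    apply mul_right_cancel₀ hne
    linear_combination h
  have h0 : conj (w i) ≠ 0 := left_ne_zero_of_mul_eq_one hwi
  exact hij (hw (mul_left_cancel₀ h0 (hwi.trans hwj.symm)))

/-- `H` is right `K`-invariant on the open cell. -/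
theorem IsBiequivariant.quot_mul {Φ : C(G, V →L[ℂ] V)} (hΦ : IsBiequivariant n e Φ) {g k : G}
    (hg : g ∈ openCell) (hk : k ∈ K) : quot n e Φ (g * k) = quot n e Φ g := by
  have hk' := det_blockA_ne_zero_of_mem hk
  have hg' : (blockA g).det ≠ 0 := hg
  have hgk : (blockA g * blockA k).det ≠ 0 := by
    rw [Matrix.det_mul]
    exact mul_ne_zero hg' hk'
  ext x
  simp only [quot, PhiPi, blockA_mul_of_mem_right g hk, ringInverse_rep n e hgk,
    ringInverse_rep n e hg', LinearMap.comp_apply, ContinuousLinearMap.coe_coe, hΦ.mul_right hk]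
  rw [Matrix.mul_inv_rev, rep_mul, Module.End.mul_apply, ← Module.End.mul_apply (rep n e (blockA k)), rep_mul_rep_inv n e hk', Module.End.one_apply]

theorem radial_mem_openCell (r : ℝ) : radial r ∈ openCell := by
  have h : (0 : ℝ) < √(1 + r ^ 2) := Real.sqrt_pos.2 (by positivity)
  change (blockA (radial r)).det ≠ 0
  simp [blockA, mat_radial, h.ne']

/-- The block `A(radial r)` is `diag((1+r²)^(-1/2), 1)`, and `v_i` has degree `ℓ-i` in `e₁`. -/
theorem IsBiequivariant.quot_radial_vec {Φ : C(G, V →L[ℂ] V)} (hΦ : IsBiequivariant n e Φ)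
    (r : ℝ) (i : Fin (ℓ + 1)) :
    quot n e Φ (radial r) (vec e i) =
      (((√(1 + r ^ 2) : ℝ) : ℂ) ^ (n + (ℓ - (i : ℕ) : ℕ)) * matEntry e Φ i (radial r)) •
        vec e i := by
  have h : (0 : ℝ) < √(1 + r ^ 2) := Real.sqrt_pos.2 (by positivity)
  have hC : ((√(1 + r ^ 2) : ℝ) : ℂ) ≠ 0 := by exact_mod_cast h.ne'
  have hb : blockA (radial r) = !![((√(1 + r ^ 2) : ℝ) : ℂ)⁻¹, 0; 0, 1] := by
    simp [blockA, mat_radial]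
  have hinv : (blockA (radial r))⁻¹ = !![((√(1 + r ^ 2) : ℝ) : ℂ), 0; 0, 1] := by
    rw [hb]
    refine Matrix.inv_eq_right_inv ?_
    simp [Matrix.one_fin_two, hC]
  rw [quot, PhiPi, ringInverse_rep n e (radial_mem_openCell r), hinv, LinearMap.comp_apply,
    rep_diagonal_vec, map_smul, ContinuousLinearMap.coe_coe,
    hΦ.apply_vec (by rfl) (by rfl) (by rfl) (by rfl), smul_smul, zpow_add₀ hC, zpow_natCast]
  simp

theorem IsBiequivariant.diagEntry_eq {Φ : C(G, V →L[ℂ] V)} (hΦ : IsBiequivariant n e Φ)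
    (r : ℝ) (i : Fin (ℓ + 1)) :
    diagEntry n e Φ i r =
      ((√(1 + r ^ 2) : ℝ) : ℂ) ^ (n + (ℓ - (i : ℕ) : ℕ)) * matEntry e Φ i (radial r) := by
  rw [diagEntry, hΦ.quot_radial_vec, ← vecBasis_repr, map_smul, ← vecBasis_apply]
  simp

/-- `H` acts diagonally at the points of the open cell over `(r, 0)`. -/
theorem IsBiequivariant.quot_apply_vec {Φ : C(G, V →L[ℂ] V)} (hΦ : IsBiequivariant n e Φ)
    {r : ℝ} {g : G} (hg : g ∈ openCell) (h0 : mat g 0 2 / mat g 2 2 = (r : ℂ))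
    (h1 : mat g 1 2 / mat g 2 2 = 0) (i : Fin (ℓ + 1)) :
    quot n e Φ g (vec e i) = diagEntry n e Φ i r • vec e i := by
  have hz : mat g 2 2 ≠ 0 := by
    intro hz
    apply hg
    rw [← conj_mat_two_two, hz, map_zero]
  have h1' : mat g 1 2 = 0 := by simpa [hz] using h1
  have h0' : mat g 0 2 = r * mat g 2 2 := by rw [← h0, div_mul_cancel₀ _ hz]
  -- The last columns of `g` and `radial r` are proportional, so `(radial r)⁻¹ g` maps the third
  -- basis vector to a multiple of itself.
  have hk : (radial r)⁻¹ * g ∈ K := by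
    refine mem_K_of_col ?_ ?_ <;> rw [mat_mul, Matrix.mul_apply] <;>
      simp only [mat_inv, Fin.sum_univ_three, h0', h1'] <;> simp [mat_radial]
    ring
  have hgk : g = radial r * ((radial r)⁻¹ * g) := by group
  rw [hgk, hΦ.quot_mul (radial_mem_openCell r) hk, hΦ.quot_radial_vec, hΦ.diagEntry_eq]

variable [FiniteDimensional ℂ V]

theorem adjoint_comp_rep (he : IsUnitaryOnK n e) {k : G} (hk : k ∈ K) :
    LinearMap.adjoint (rep n e (blockA k)) ∘ₗ rep n e (blockA k) = LinearMap.id := by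
  ext x
  refine ext_inner_right ℂ fun y => ?_
  rw [LinearMap.comp_apply, LinearMap.adjoint_inner_left, he k hk, LinearMap.id_apply]

theorem rep_comp_adjoint (he : IsUnitaryOnK n e) {k : G} (hk : k ∈ K) :
    rep n e (blockA k) ∘ₗ LinearMap.adjoint (rep n e (blockA k)) = LinearMap.id :=
  mul_eq_one_comm.1 (adjoint_comp_rep he hk)

/-- The factor `π(k₂)π(k₂)*` cancels in the middle; `π(k₁)` and its adjoint meet by cyclicity of the
trace. -/
theorem trMulAdj_mul_mul (he : IsUnitaryOnK n e) {Φ Ψ : C(G, V →L[ℂ] V)}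
    (hΦ : IsBiequivariant n e Φ) (hΨ : IsBiequivariant n e Ψ) {k₁ k₂ : G} (hk₁ : k₁ ∈ K)
    (hk₂ : k₂ ∈ K) (g : G) : trMulAdj Φ Ψ (k₁ * g * k₂) = trMulAdj Φ Ψ g := by
  have h : ∀ {Φ : C(G, V →L[ℂ] V)}, IsBiequivariant n e Φ → (Φ (k₁ * g * k₂)).toLinearMap =
      rep n e (blockA k₁) ∘ₗ (Φ g).toLinearMap ∘ₗ rep n e (blockA k₂) := by
    intro Φ hΦ
    ext x
    exact hΦ k₁ hk₁ k₂ hk₂ g x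
  rw [trMulAdj, trMulAdj, h hΦ, h hΨ, LinearMap.adjoint_comp, LinearMap.adjoint_comp]
  have h2 := rep_comp_adjoint he hk₂
  have h1 := adjoint_comp_rep he hk₁
  generalize rep n e (blockA k₂) = P at *
  generalize rep n e (blockA k₁) = Q at *
  generalize (Φ g).toLinearMap = S at *
  generalize LinearMap.adjoint (Ψ g).toLinearMap = T at *
  calc LinearMap.trace ℂ V ((Q ∘ₗ S ∘ₗ P) ∘ₗ (LinearMap.adjoint P ∘ₗ T) ∘ₗ LinearMap.adjoint Q)
      = LinearMap.trace ℂ V (Q * (S * (P ∘ₗ LinearMap.adjoint P) * T * LinearMap.adjoint Q)) := rfl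
    _ = LinearMap.trace ℂ V (S * T * (LinearMap.adjoint Q ∘ₗ Q)) := by
        rw [LinearMap.trace_mul_comm, h2]
        rfl
    _ = LinearMap.trace ℂ V (S ∘ₗ T) := by rw [h1]; rfl

theorem trMulAdj_eq_cartan (he : IsUnitaryOnK n e) {Φ Ψ : C(G, V →L[ℂ] V)}
    (hΦ : IsBiequivariant n e Φ) (hΨ : IsBiequivariant n e Ψ) (g : G) :
    trMulAdj Φ Ψ g = trMulAdj Φ Ψ (cartan (‖mat g 2 2‖ ^ 2)) := by
  obtain ⟨k₁, hk₁, k₂, hk₂, h⟩ := exists_mul_cartan_mul g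
  conv_lhs => rw [h]
  exact trMulAdj_mul_mul he hΦ hΨ hk₁ hk₂ _

/-- Both operators are diagonal in an orthogonal basis, so the adjoint has the conjugate entries;
normalization of the `v_i` is irrelevant. -/
theorem trMulAdj_cartan (he : IsUnitaryOnK n e) {Φ Ψ : C(G, V →L[ℂ] V)}
    (hΦ : IsBiequivariant n e Φ) (hΨ : IsBiequivariant n e Ψ) (t : ℝ) :
    trMulAdj Φ Ψ (cartan t) =
      ∑ i, matEntry e Φ i (cartan t) * conj (matEntry e Ψ i (cartan t)) := by
  have hΦv : ∀ i, Φ (cartan t) (vec e i) = _ := hΦ.apply_vec (by rfl) (by rfl) (by rfl) (by rfl)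
  have hΨv : ∀ i, Ψ (cartan t) (vec e i) = _ := hΨ.apply_vec (by rfl) (by rfl) (by rfl) (by rfl)
  have hadj : ∀ i, LinearMap.adjoint (Ψ (cartan t)).toLinearMap (vec e i) =
      conj (matEntry e Ψ i (cartan t)) • vec e i := by
    intro i
    refine InnerProductSpace.ext_inner_left_basis (vecBasis e) fun j => ?_
    rw [vecBasis_apply, LinearMap.adjoint_inner_right, ContinuousLinearMap.coe_coe, hΨv,
      inner_smul_left, inner_smul_right]
    by_cases hij : j = i
    · rw [hij]
    · rw [he.inner_vec hij]
      simp
  rw [trMulAdj, LinearMap.trace_eq_matrix_trace ℂ (vecBasis e), Matrix.trace]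
  refine Finset.sum_congr rfl fun i _ => ?_
  rw [Matrix.diag_apply, LinearMap.toMatrix_apply, vecBasis_apply, LinearMap.comp_apply, hadj,
    map_smul, ContinuousLinearMap.coe_coe, hΦv, ← vecBasis_apply]
  simp [mul_comm]

theorem continuous_matEntry (Φ : C(G, V →L[ℂ] V)) (i : Fin (ℓ + 1)) :
    Continuous (matEntry e Φ i) :=
  (LinearMap.continuous_of_finiteDimensional ((vecBasis e).coord i)).comp
    (Φ.continuous.clm_apply continuous_const)

end Representation

section Law

/-! ### The law of `|g₃₃|²` under the Haar measure -/

/-- The isometry of `ℂ³` defined by an element of `SU(3)`. -/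
def toIsometry (g : G) : EuclideanSpace ℂ (Fin 3) ≃ₗᵢ[ℝ] EuclideanSpace ℂ (Fin 3) where
  toFun v := WithLp.toLp 2 (Matrix.mulVec (mat g) v.ofLp)
  invFun v := WithLp.toLp 2 (Matrix.mulVec (mat g⁻¹) v.ofLp)
  map_add' v w := by ext i; simp [Matrix.mulVec_add]
  map_smul' c v := by ext i; simp [Matrix.mulVec_smul]
  left_inv v := by
    simp only [Matrix.mulVec_mulVec, ← mat_mul, inv_mul_cancel]
    simp [mat]
  right_inv v := by
    simp only [Matrix.mulVec_mulVec, ← mat_mul, mul_inv_cancel]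
    simp [mat]
  norm_map' v := by
    have hg : star (mat g) * mat g = 1 := Matrix.mem_unitaryGroup_iff'.1
      (Matrix.mem_specialUnitaryGroup_iff.1 g.2).1
    have h : (inner ℂ (WithLp.toLp 2 (Matrix.mulVec (mat g) v.ofLp) : EuclideanSpace ℂ (Fin 3))
        (WithLp.toLp 2 (Matrix.mulVec (mat g) v.ofLp)) : ℂ) = inner ℂ v v := by
      rw [EuclideanSpace.inner_eq_star_dotProduct, EuclideanSpace.inner_eq_star_dotProduct,
        dotProduct_comm, Matrix.star_mulVec, ← Matrix.dotProduct_mulVec, Matrix.mulVec_mulVec,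
        ← Matrix.star_eq_conjTranspose, hg, Matrix.one_mulVec, dotProduct_comm]
    rw [inner_self_eq_norm_sq_to_K, inner_self_eq_norm_sq_to_K] at h
    have h' : ‖(WithLp.toLp 2 (Matrix.mulVec (mat g) v.ofLp) : EuclideanSpace ℂ (Fin 3))‖ ^ 2 =
        ‖v‖ ^ 2 := by exact_mod_cast h
    exact (sq_eq_sq₀ (norm_nonneg _) (norm_nonneg _)).1 h'

/-- The product Lebesgue measure on `ℂ³`. -/
def lebesgue : Measure (EuclideanSpace ℂ (Fin 3)) :=
  (volume : Measure (Fin 3 → ℂ)).map (MeasurableEquiv.toLp 2 (Fin 3 → ℂ))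

instance isAddHaarMeasure_lebesgue : lebesgue.IsAddHaarMeasure :=
  (PiLp.continuousLinearEquiv 2 ℝ fun _ : Fin 3 => ℂ).symm.isAddHaarMeasure_map volume

/-- By uniqueness of Haar measure `lebesgue` is a multiple of the Euclidean volume, which isometries
preserve. -/
theorem integral_comp_toIsometry (g : G) (f : EuclideanSpace ℂ (Fin 3) → ℝ) :
    ∫ v, f (toIsometry g v) ∂lebesgue = ∫ v, f v ∂lebesgue := by
  have h := Measure.isAddLeftInvariant_eq_smul lebesgue
    (volume : Measure (EuclideanSpace ℂ (Fin 3)))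
  rw [h, integral_smul_nnreal_measure, integral_smul_nnreal_measure,
    (toIsometry g).measurePreserving.integral_comp
      (toIsometry g).toHomeomorph.measurableEmbedding]

/-! ### Gaussian moments on `ℂ³` -/

theorem integral_complex_pow_mul_exp (k : ℕ) :
    ∫ z : ℂ, (‖z‖ ^ 2) ^ k * Real.exp (-‖z‖ ^ 2) = Real.pi * k.factorial := by
  have h := Complex.integral_rpow_mul_exp_neg_rpow (p := 2) (q := 2 * k) (by norm_num)
    (by have : (0 : ℝ) ≤ k := by positivity
        linarith)
  rw [show ((2 : ℝ) * k + 2) / 2 = k + 1 by ring, Real.Gamma_nat_eq_factorial] at h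
  rw [show Real.pi * k.factorial = 2 * Real.pi / 2 * k.factorial by ring, ← h]
  refine integral_congr_ae (Filter.Eventually.of_forall fun z => ?_)
  simp only [Real.rpow_two]
  rw [← pow_mul, ← Real.rpow_natCast]
  push_cast
  rfl

theorem integral_coord_pow_mul_exp (k : ℕ) :
    ∫ v, (‖v 2‖ ^ 2) ^ k * Real.exp (-‖v‖ ^ 2) ∂lebesgue = Real.pi ^ 3 * k.factorial := by
  rw [lebesgue, integral_map_equiv]
  have h := integral_fintype_prod_volume_eq_prod (ι := Fin 3) (𝕜 := ℝ) (E := fun _ => ℂ)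
    (fun i z => (‖z‖ ^ 2) ^ (![0, 0, k] i) * Real.exp (-‖z‖ ^ 2))
  simp only [integral_complex_pow_mul_exp, Fin.prod_univ_three] at h
  rw [show Real.pi ^ 3 * k.factorial = Real.pi * (![0, 0, k] 0).factorial *
    (Real.pi * (![0, 0, k] 1).factorial) * (Real.pi * (![0, 0, k] 2).factorial) by simp; ring, ← h]
  refine integral_congr_ae (Filter.Eventually.of_forall fun z => ?_)
  simp only [MeasurableEquiv.coe_toLp, EuclideanSpace.norm_sq_eq, Fin.sum_univ_three]
  rw [neg_add, neg_add, Real.exp_add, Real.exp_add]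
  simp
  ring

/-- The radius-dependent constant in polar coordinates of `ℂ³`. -/
def polarConst : ℝ := 6 * lebesgue.real (Metric.ball 0 1)

theorem finrank_euclidean : Module.finrank ℝ (EuclideanSpace ℂ (Fin 3)) = 6 := by
  rw [finrank_real_of_complex, finrank_euclideanSpace]
  simp

theorem integral_norm_pow_mul_exp (k : ℕ) :
    ∫ v, (‖v‖ ^ 2) ^ k * Real.exp (-‖v‖ ^ 2) ∂lebesgue =
      polarConst * ((k + 2).factorial / 2) := by
  rw [integral_fun_norm_addHaar lebesgue fun y => (y ^ 2) ^ k * Real.exp (-y ^ 2),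
    finrank_euclidean]
  -- Real dimension 6 contributes `y^5` to the power `y^(2k)`.
  have h := integral_rpow_mul_exp_neg_rpow (p := 2) (q := 2 * k + 5) (by norm_num)
    (by have : (0 : ℝ) ≤ k := by positivity
        linarith)
  rw [show ((2 : ℝ) * k + 5 + 1) / 2 = ((k + 2 : ℕ) : ℝ) + 1 by push_cast; ring,
    Real.Gamma_nat_eq_factorial] at h
  have h' : ∫ y in Set.Ioi (0 : ℝ), y ^ (6 - 1) • ((y ^ 2) ^ k * Real.exp (-y ^ 2)) =
      (k + 2).factorial / 2 := by
    rw [show ((k + 2).factorial : ℝ) / 2 = 1 / 2 * (k + 2).factorial by ring, ← h]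
    refine setIntegral_congr_fun measurableSet_Ioi fun y hy => ?_
    simp only [smul_eq_mul, Real.rpow_two]
    rw [← mul_assoc, ← pow_mul, ← pow_add, ← Real.rpow_natCast]
    push_cast
    ring_nf
  rw [h', polarConst]
  simp [mul_assoc]

/-- For `k = 0` the product and polar formulas evaluate the same Gaussian integral, which gives the
constant without the volume of the ball. -/
theorem polarConst_eq : polarConst = Real.pi ^ 3 := by
  have h1 := integral_coord_pow_mul_exp 0
  have h2 := integral_norm_pow_mul_exp 0
  simp only [pow_zero] at h1 h2
  rw [h1] at h2
  simp at h2
  exact h2.symm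

theorem integrable_norm_pow_mul_exp (k : ℕ) :
    Integrable (fun v => (‖v‖ ^ 2) ^ k * Real.exp (-‖v‖ ^ 2)) lebesgue := by
  -- The integral of a non-integrable function is 0 by convention.
  refine Integrable.of_integral_ne_zero ?_
  rw [integral_norm_pow_mul_exp, polarConst_eq]
  positivity

/-- Every vector of `ℂ³` is a multiple of the last column of an element of `SU(3)`. -/
theorem exists_eq_norm_mul_col (v : EuclideanSpace ℂ (Fin 3)) :
    ∃ h : G, ∀ i, v i = ‖v‖ * mat h i 2 := by
  by_cases hv : v = 0
  · exact ⟨1, by simp [hv]⟩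
  have hn : ‖v‖ ≠ 0 := norm_ne_zero_iff.2 hv
  have hC : (‖v‖ : ℂ) ≠ 0 := by exact_mod_cast hn
  have hs : ‖v 0‖ ^ 2 + ‖v 1‖ ^ 2 + ‖v 2‖ ^ 2 = ‖v‖ ^ 2 := by
    rw [EuclideanSpace.norm_sq_eq, Fin.sum_univ_three]
  obtain ⟨k, -, h0, h1, h2⟩ := exists_mem_K_mul_cartan_col (v 0 / ‖v‖) (v 1 / ‖v‖) (v 2 / ‖v‖) (by
    simp only [norm_div, Complex.norm_real, norm_norm, div_pow]
    rw [← add_div, ← add_div, hs, div_self (pow_ne_zero 2 hn)])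
  refine ⟨k * cartan (‖v 2 / ‖v‖‖ ^ 2), fun i => ?_⟩
  fin_cases i
  · exact (mul_div_cancel₀ (v 0) hC).symm.trans (congrArg _ h0.symm)
  · exact (mul_div_cancel₀ (v 1) hC).symm.trans (congrArg _ h1.symm)
  · exact (mul_div_cancel₀ (v 2) hC).symm.trans (congrArg _ h2.symm)

theorem continuous_mat (i j : Fin 3) : Continuous fun g : G => mat g i j :=
  continuous_subtype_val.matrix_elem i j

theorem norm_mat_sq_mem (g : G) : ‖mat g 2 2‖ ^ 2 ∈ Set.Icc (0 : ℝ) 1 :=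
  ⟨by positivity, by nlinarith [normSq_col g, sq_nonneg ‖mat g 0 2‖, sq_nonneg ‖mat g 1 2‖]⟩

theorem integral_beta_pow (k : ℕ) :
    ∫ t in (0 : ℝ)..1, 2 * (1 - t) * t ^ k = 2 / ((k + 1) * (k + 2)) := by
  have h : ∀ t : ℝ, 2 * (1 - t) * t ^ k = 2 * t ^ k - 2 * t ^ (k + 1) := fun t => by ring
  simp only [h]
  rw [intervalIntegral.integral_sub (Continuous.intervalIntegrable (by fun_prop) _ _)
    (Continuous.intervalIntegrable (by fun_prop) _ _), intervalIntegral.integral_const_mul,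
    intervalIntegral.integral_const_mul, integral_pow, integral_pow]
  push_cast
  field_simp
  simp
  ring

/-! ### Moments under Haar measure and polynomial approximation -/

variable [MeasurableSpace G] [BorelSpace G]

theorem integrable_comp_norm_mat_sq {F : Type*} [NormedAddCommGroup F]
    [SecondCountableTopology F] (μ : Measure G) [IsFiniteMeasure μ] {f : ℝ → F}
    (hf : Continuous f) : Integrable (fun g : G => f (‖mat g 2 2‖ ^ 2)) μ := by
  obtain ⟨C, hC⟩ := isCompact_Icc.exists_bound_of_continuousOn
    (hf.continuousOn (s := Set.Icc (0 : ℝ) 1))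
  refine Integrable.of_bound
    (hf.comp ((continuous_mat 2 2).norm.pow 2)).aestronglyMeasurable C ?_
  exact Filter.Eventually.of_forall fun g => hC _ (norm_mat_sq_mem g)

/-- This justifies Fubini: `|(g⁻¹v)₃| ≤ |v|` bounds the integrand by a Gaussian moment independent
of `g`. -/
theorem integrable_average (μ : Measure G) [IsProbabilityMeasure μ] (k : ℕ) :
    Integrable (Function.uncurry fun (g : G) (v : EuclideanSpace ℂ (Fin 3)) =>
      (‖toIsometry g⁻¹ v 2‖ ^ 2) ^ k * Real.exp (-‖v‖ ^ 2)) (μ.prod lebesgue) := by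
  refine ((integrable_norm_pow_mul_exp k).comp_snd μ).mono' ?_ ?_
  · refine Continuous.aestronglyMeasurable ?_
    have h : ∀ (g : G) (v : EuclideanSpace ℂ (Fin 3)),
        toIsometry g⁻¹ v 2 = ∑ j, conj (mat g j 2) * v j := fun g v => rfl
    have h1 : ∀ j, Continuous fun p : G × EuclideanSpace ℂ (Fin 3) => conj (mat p.1 j 2) :=
      fun j => Complex.continuous_conj.comp ((continuous_mat j 2).comp continuous_fst)
    have h2 : ∀ j, Continuous fun p : G × EuclideanSpace ℂ (Fin 3) => p.2 j :=
      fun j => (EuclideanSpace.proj (𝕜 := ℂ) j).continuous.comp continuous_snd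
    have h3 : Continuous fun p : G × EuclideanSpace ℂ (Fin 3) => toIsometry p.1⁻¹ p.2 2 := by
      simp only [h]
      exact continuous_finsetSum _ fun j _ => (h1 j).mul (h2 j)
    exact ((h3.norm.pow 2).pow k).mul (Real.continuous_exp.comp (continuous_snd.norm.pow 2).neg)
  · refine Filter.Eventually.of_forall fun p => ?_
    rw [Function.uncurry_def, Real.norm_eq_abs, abs_of_nonneg (by positivity)]
    have h : ‖toIsometry p.1⁻¹ p.2 2‖ ≤ ‖p.2‖ := by
      rw [← (toIsometry p.1⁻¹).norm_map p.2]
      exact PiLp.norm_apply_le _ _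
    dsimp only
    gcongr

variable (μ : Measure G) [μ.IsHaarMeasure]

/-- Averaging over the group turns a coordinate into a multiple of the norm. -/
theorem integral_norm_inv_apply (v : EuclideanSpace ℂ (Fin 3)) (k : ℕ) :
    ∫ g, (‖toIsometry g⁻¹ v 2‖ ^ 2) ^ k ∂μ =
      (‖v‖ ^ 2) ^ k * ∫ g, (‖mat g 2 2‖ ^ 2) ^ k ∂μ := by
  obtain ⟨h, hv⟩ := exists_eq_norm_mul_col v
  -- With `v = |v| h e₃`, the coordinate is `|v| (g⁻¹h)₃₃`, whose modulus is `|v| |(h⁻¹g)₃₃|`; left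
  -- invariance then removes `h`.
  have key : ∀ g : G, (‖toIsometry g⁻¹ v 2‖ ^ 2) ^ k =
      (‖v‖ ^ 2) ^ k * (‖mat (h⁻¹ * g) 2 2‖ ^ 2) ^ k := by
    intro g
    have h1 : toIsometry g⁻¹ v 2 = ‖v‖ * mat (g⁻¹ * h) 2 2 := by
      change Matrix.mulVec (mat g⁻¹) v.ofLp 2 = _
      rw [mat_mul, Matrix.mul_apply, Matrix.mulVec, dotProduct, Finset.mul_sum]
      refine Finset.sum_congr rfl fun i _ => ?_
      rw [hv i]
      ring
    have h2 : ‖mat (g⁻¹ * h) 2 2‖ = ‖mat (h⁻¹ * g) 2 2‖ := by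
      rw [show g⁻¹ * h = (h⁻¹ * g)⁻¹ by group, mat_inv, RCLike.norm_conj]
    rw [h1, norm_mul, h2, Complex.norm_real, norm_norm, mul_pow, mul_pow]
  simp only [key]
  rw [integral_const_mul, integral_mul_left_eq_self (μ := μ)
    (fun g : G => (‖mat g 2 2‖ ^ 2) ^ k) h⁻¹]

variable [IsProbabilityMeasure μ]

/-- Integrating over `v` first gives `π³ k!`, because `g⁻¹` is an isometry. Integrating over `g`
first gives the moment times `π³ (k+2)!/2`. -/
theorem integral_norm_mat_sq_pow (k : ℕ) :
    ∫ g, (‖mat g 2 2‖ ^ 2) ^ k ∂μ = 2 / ((k + 1) * (k + 2)) := by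
  have h := integral_integral_swap (integrable_average μ k)
  have h1 : ∀ g : G, ∫ v, (‖toIsometry g⁻¹ v 2‖ ^ 2) ^ k * Real.exp (-‖v‖ ^ 2) ∂lebesgue =
      Real.pi ^ 3 * k.factorial := by
    intro g
    rw [← integral_coord_pow_mul_exp, ← integral_comp_toIsometry g⁻¹
      fun v => (‖v 2‖ ^ 2) ^ k * Real.exp (-‖v‖ ^ 2)]
    simp only [LinearIsometryEquiv.norm_map]
  simp only [h1, integral_const, probReal_univ, one_smul, integral_mul_const,
    integral_norm_inv_apply μ] at h
  have h2 : ∀ (c : ℝ), ∫ v, (‖v‖ ^ 2) ^ k * c * Real.exp (-‖v‖ ^ 2) ∂lebesgue =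
      c * (polarConst * ((k + 2).factorial / 2)) := by
    intro c
    rw [← integral_norm_pow_mul_exp, ← integral_const_mul]
    refine integral_congr_ae (Filter.Eventually.of_forall fun v => ?_)
    dsimp only
    ring
  rw [h2, polarConst_eq, Nat.factorial_succ, Nat.factorial_succ] at h
  push_cast at h
  generalize ∫ g, (‖mat g 2 2‖ ^ 2) ^ k ∂μ = M at h ⊢
  have hpi : Real.pi ^ 3 * (k.factorial : ℝ) ≠ 0 := by positivity
  have hk : ((k : ℝ) + 1) * (k + 2) ≠ 0 := by positivity
  rw [eq_div_iff hk]
  apply mul_left_cancel₀ hpi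
  linear_combination -2 * h

theorem integral_comp_norm_mat_sq_polynomial (p : Polynomial ℝ) :
    ∫ g, p.eval (‖mat g 2 2‖ ^ 2) ∂μ = ∫ t in (0 : ℝ)..1, 2 * (1 - t) * p.eval t := by
  induction p using Polynomial.induction_on' with
  | add p q hp hq =>
    simp only [Polynomial.eval_add, mul_add]
    rw [integral_add (integrable_comp_norm_mat_sq μ p.continuous)
      (integrable_comp_norm_mat_sq μ q.continuous), hp, hq, intervalIntegral.integral_add]
    · exact Continuous.intervalIntegrable (by fun_prop) _ _
    · exact Continuous.intervalIntegrable (by fun_prop) _ _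
  | monomial k a =>
    simp only [Polynomial.eval_monomial]
    rw [integral_const_mul, integral_norm_mat_sq_pow, ← integral_beta_pow,
      ← intervalIntegral.integral_const_mul]
    congr 1
    ext t
    ring

/-- The law of `|g₃₃|²` has density `2 (1 - t)` on `[0, 1]`, for real test functions. -/
theorem integral_comp_norm_mat_sq_real {f : ℝ → ℝ} (hf : Continuous f) :
    ∫ g, f (‖mat g 2 2‖ ^ 2) ∂μ = ∫ t in (0 : ℝ)..1, 2 * (1 - t) * f t := by
  refine eq_of_abs_sub_le_all fun ε hε => ?_
  -- The approximation costs `ε/3` on the group and at most `2ε/3` on `[0,1]`, where the density is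
  -- at most 2.
  obtain ⟨p, hp⟩ := exists_polynomial_near_of_continuousOn 0 1 f hf.continuousOn (ε / 3)
    (by positivity)
  have h1 : |∫ g, (f (‖mat g 2 2‖ ^ 2) - p.eval (‖mat g 2 2‖ ^ 2)) ∂μ| ≤ ε / 3 := by
    have := norm_integral_le_of_norm_le_const (μ := μ) (C := ε / 3)
      (f := fun g => f (‖mat g 2 2‖ ^ 2) - p.eval (‖mat g 2 2‖ ^ 2))
      (Filter.Eventually.of_forall fun g => by
        rw [Real.norm_eq_abs, abs_sub_comm]
        exact (hp _ (norm_mat_sq_mem g)).le)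
    simpa using this
  have h2 : |∫ t in (0 : ℝ)..1, (2 * (1 - t) * p.eval t - 2 * (1 - t) * f t)| ≤ 2 * (ε / 3) := by
    have := intervalIntegral.norm_integral_le_of_norm_le_const (a := (0 : ℝ)) (b := 1)
      (C := 2 * (ε / 3)) (f := fun t => 2 * (1 - t) * p.eval t - 2 * (1 - t) * f t)
      (fun t ht => by
        rw [Set.uIoc_of_le zero_le_one] at ht
        rw [← mul_sub, norm_mul, Real.norm_eq_abs, Real.norm_eq_abs,
          abs_of_nonneg (by linarith [ht.2])]
        have := hp t ⟨ht.1.le, ht.2⟩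
        gcongr
        linarith [ht.1])
    simpa using this
  rw [integral_sub (integrable_comp_norm_mat_sq μ hf)
    (integrable_comp_norm_mat_sq μ p.continuous), integral_comp_norm_mat_sq_polynomial] at h1
  rw [intervalIntegral.integral_sub (Continuous.intervalIntegrable (by fun_prop) _ _)
    (Continuous.intervalIntegrable (by fun_prop) _ _)] at h2
  rw [abs_le] at *
  constructor <;> linarith [h1.1, h1.2, h2.1, h2.2]

/-- The law of `|g₃₃|²` has density `2 (1 - t)` on `[0, 1]`. -/
theorem integral_comp_norm_mat_sq {f : ℝ → ℂ} (hf : Continuous f) :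
    ∫ g, f (‖mat g 2 2‖ ^ 2) ∂μ = ∫ t in (0 : ℝ)..1, ((2 * (1 - t) : ℝ) : ℂ) * f t := by
  have hint : IntervalIntegrable (fun t : ℝ => ((2 * (1 - t) : ℝ) : ℂ) * f t) volume 0 1 :=
    Continuous.intervalIntegrable (by fun_prop) _ _
  have hre := integral_comp_norm_mat_sq_real μ (Complex.continuous_re.comp hf)
  have him := integral_comp_norm_mat_sq_real μ (Complex.continuous_im.comp hf)
  have hi := integrable_comp_norm_mat_sq μ hf
  rw [intervalIntegral.integral_of_le zero_le_one] at *
  have hint' := hint.1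
  apply Complex.ext
  · have h1 := integral_re hi
    have h2 := integral_re hint'
    simp only [RCLike.re_to_complex, Complex.re_ofReal_mul] at h1 h2
    rw [← h1, ← h2]
    exact hre
  · have h1 := integral_im hi
    have h2 := integral_im hint'
    simp only [RCLike.im_to_complex, Complex.im_ofReal_mul] at h1 h2
    rw [← h1, ← h2]
    exact him

end Law

/-! ### Change of variables -/

theorem hasDerivAt_one_div_one_add_sq (r : ℝ) :
    HasDerivAt (fun r : ℝ => 1 / (1 + r ^ 2)) (-(2 * r) / (1 + r ^ 2) ^ 2) r := by
  have h : HasDerivAt (fun r : ℝ => 1 + r ^ 2) (2 * r) r := by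
    simpa using (hasDerivAt_pow 2 r).const_add 1
  simp only [one_div]
  exact h.inv (by positivity)

theorem injOn_one_div_one_add_sq :
    Set.InjOn (fun r : ℝ => 1 / (1 + r ^ 2)) (Set.Ioi 0) := by
  intro a ha b hb hab
  simp only [one_div, inv_inj, add_right_inj] at hab
  exact (sq_eq_sq₀ (le_of_lt ha) (le_of_lt hb)).1 hab

theorem image_one_div_one_add_sq :
    (fun r : ℝ => 1 / (1 + r ^ 2)) '' Set.Ioi 0 = Set.Ioo 0 1 := by
  ext t
  constructor
  · rintro ⟨r, hr, rfl⟩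
    have hr' : (0 : ℝ) < r := hr
    refine ⟨by positivity, ?_⟩
    dsimp only
    rw [div_lt_one (by positivity)]
    nlinarith
  · rintro ⟨h0, h1⟩
    have h : 0 < (1 - t) / t := div_pos (by linarith) h0
    refine ⟨√((1 - t) / t), Real.sqrt_pos.2 h, ?_⟩
    dsimp only
    rw [Real.sq_sqrt h.le]
    field_simp
    ring

/-- For `t = 1/(1+r²)` one has `1-t = r²/(1+r²)` and `|dt/dr| = 2r/(1+r²)²`. -/
theorem abs_deriv_smul_eq (q : ℝ → ℂ) {r : ℝ} (hr : r ∈ Set.Ioi (0 : ℝ)) :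
    |-(2 * r) / (1 + r ^ 2) ^ 2| •
        (((2 * (1 - 1 / (1 + r ^ 2)) : ℝ) : ℂ) * q (1 / (1 + r ^ 2))) =
      4 * (((r ^ 3 * ((1 + r ^ 2) ^ 3)⁻¹ : ℝ) : ℂ) * q (1 / (1 + r ^ 2))) := by
  have hr' : (0 : ℝ) < r := hr
  have h : |-(2 * r) / (1 + r ^ 2) ^ 2| * (2 * (1 - 1 / (1 + r ^ 2))) =
      4 * (r ^ 3 * ((1 + r ^ 2) ^ 3)⁻¹) := by
    rw [abs_div, abs_neg, abs_of_pos (by positivity : 0 < 2 * r), abs_of_pos (by positivity)]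
    field_simp
    ring
  rw [Complex.real_smul, ← mul_assoc, ← Complex.ofReal_mul, h]
  push_cast
  ring

theorem integrableOn_radial {q : ℝ → ℂ} (hq : Continuous q) :
    IntegrableOn (fun r : ℝ => ((r ^ 3 * ((1 + r ^ 2) ^ 3)⁻¹ : ℝ) : ℂ) * q (1 / (1 + r ^ 2)))
      (Set.Ioi 0) := by
  have h1 : IntegrableOn (fun t : ℝ => ((2 * (1 - t) : ℝ) : ℂ) * q t)
      ((fun r : ℝ => 1 / (1 + r ^ 2)) '' Set.Ioi 0) := by
    rw [image_one_div_one_add_sq]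
    exact (Continuous.integrableOn_Icc (by fun_prop)).mono_set Set.Ioo_subset_Icc_self
  rw [integrableOn_image_iff_integrableOn_abs_deriv_smul measurableSet_Ioi
    (fun r _ => (hasDerivAt_one_div_one_add_sq r).hasDerivWithinAt) injOn_one_div_one_add_sq,
    integrableOn_congr_fun (fun r hr => abs_deriv_smul_eq q hr) measurableSet_Ioi] at h1
  have h2 := h1.const_mul (4⁻¹ : ℂ)
  simpa [IntegrableOn] using h2

theorem integral_radial (q : ℝ → ℂ) :
    ∫ t in (0 : ℝ)..1, ((2 * (1 - t) : ℝ) : ℂ) * q t =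
      4 * ∫ r in Set.Ioi (0 : ℝ),
        ((r ^ 3 * ((1 + r ^ 2) ^ 3)⁻¹ : ℝ) : ℂ) * q (1 / (1 + r ^ 2)) := by
  rw [intervalIntegral.integral_of_le zero_le_one, integral_Ioc_eq_integral_Ioo,
    ← image_one_div_one_add_sq,
    integral_image_eq_integral_abs_deriv_smul measurableSet_Ioi
      (fun r _ => (hasDerivAt_one_div_one_add_sq r).hasDerivWithinAt) injOn_one_div_one_add_sq,
    setIntegral_congr_fun measurableSet_Ioi (fun r hr => abs_deriv_smul_eq q hr),
    integral_const_mul]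

/-! ### Comparison of the weights -/

section Representation

variable {V : Type*} [NormedAddCommGroup V] [InnerProductSpace ℂ V] {n : ℤ} {ℓ : ℕ}
  {e : SymPow ℓ ≃ₗ[ℂ] V}

/-- Each of `h_i` and `f_i` carries a factor `√(1+r²)^(n+ℓ-i)`; together they reduce the exponent
`-(n+ℓ+3-i)` to `-3`. -/
theorem weight_mul_diagEntry_mul_conj {Φ Ψ : C(G, V →L[ℂ] V)} (hΦ : IsBiequivariant n e Φ)
    (hΨ : IsBiequivariant n e Ψ) (i : Fin (ℓ + 1)) {r : ℝ} (hr : 0 ≤ r) :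
    ((r ^ 3 * (1 + r ^ 2) ^ (-(n + ℓ + 3 - (i : ℕ))) : ℝ) : ℂ) *
        diagEntry n e Φ i r * conj (diagEntry n e Ψ i r) =
      ((r ^ 3 * ((1 + r ^ 2) ^ 3)⁻¹ : ℝ) : ℂ) *
        (matEntry e Φ i (cartan (1 / (1 + r ^ 2))) *
          conj (matEntry e Ψ i (cartan (1 / (1 + r ^ 2))))) := by
  have hp : (0 : ℝ) < 1 + r ^ 2 := by positivity
  have hs : √(1 + r ^ 2) * √(1 + r ^ 2) = 1 + r ^ 2 := Real.mul_self_sqrt hp.le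
  have hm : n + ((ℓ - (i : ℕ) : ℕ) : ℤ) = n + ℓ - (i : ℕ) := by
    have := i.is_le
    omega
  have key : (1 + r ^ 2) ^ (-(n + ℓ + 3 - (i : ℕ))) *
      (√(1 + r ^ 2) ^ (n + ℓ - (i : ℕ)) * √(1 + r ^ 2) ^ (n + ℓ - (i : ℕ))) =
      ((1 + r ^ 2) ^ 3)⁻¹ := by
    rw [← mul_zpow, hs, ← zpow_add₀ hp.ne', ← zpow_natCast (1 + r ^ 2) 3, ← zpow_neg]
    congr 1
    push_cast
    ring
  have keyC : (((1 + r ^ 2) ^ (-(n + ℓ + 3 - (i : ℕ))) : ℝ) : ℂ) *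
      (((√(1 + r ^ 2) : ℝ) : ℂ) ^ (n + ℓ - (i : ℕ)) *
        ((√(1 + r ^ 2) : ℝ) : ℂ) ^ (n + ℓ - (i : ℕ))) = ((((1 + r ^ 2) ^ 3)⁻¹ : ℝ) : ℂ) := by
    rw [← key]
    push_cast
    rfl
  rw [hΦ.diagEntry_eq, hΨ.diagEntry_eq, hm, ← radial_eq_cartan hr, map_mul, map_zpow₀,
    Complex.conj_ofReal, Complex.ofReal_mul, Complex.ofReal_mul, ← keyC]
  ring

end Representation

end SphericalSU3

end

/-! ### The integral formula -/

open SphericalSU3 in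
theorem proposition7p1 (n : ℤ) (ℓ : ℕ)
    {V : Type*} [NormedAddCommGroup V] [InnerProductSpace ℂ V] [FiniteDimensional ℂ V]
    (e : SymPow ℓ ≃ₗ[ℂ] V) (he : IsUnitaryOnK n e)
    [MeasurableSpace G] [BorelSpace G] (μ : Measure G) [μ.IsHaarMeasure] [IsProbabilityMeasure μ]
    (Φ Ψ : C(G, V →L[ℂ] V)) (hΦ : IsBiequivariant n e Φ) (hΨ : IsBiequivariant n e Ψ) :
    -- `H` and `F` are diagonal with entries `h_i(r)`, `f_i(r)` over the point `(r, 0)`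
    (∀ r : ℝ, 0 ≤ r → ∀ g ∈ openCell,
      mat g 0 2 / mat g 2 2 = (r : ℂ) → mat g 1 2 / mat g 2 2 = 0 → ∀ i : Fin (ℓ + 1),
        quot n e Φ g (vec e i) = diagEntry n e Φ i r • vec e i ∧
        quot n e Ψ g (vec e i) = diagEntry n e Ψ i r • vec e i) ∧
    -- both sides of the formula are absolutely convergent
    Integrable (trMulAdj Φ Ψ) μ ∧
    (∀ i : Fin (ℓ + 1), IntegrableOn
      (fun r : ℝ => ((r ^ 3 * (1 + r ^ 2) ^ (-(n + ℓ + 3 - (i : ℕ))) : ℝ) : ℂ) *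
        diagEntry n e Φ i r * conj (diagEntry n e Ψ i r)) (Set.Ioi 0)) ∧
    -- the formula
    ∫ g, trMulAdj Φ Ψ g ∂μ =
      4 * ∑ i : Fin (ℓ + 1), ∫ r in Set.Ioi (0 : ℝ),
        ((r ^ 3 * (1 + r ^ 2) ^ (-(n + ℓ + 3 - (i : ℕ))) : ℝ) : ℂ) *
          diagEntry n e Φ i r * conj (diagEntry n e Ψ i r) := by
  have hq : ∀ i, Continuous fun t : ℝ =>
      matEntry e Φ i (cartan t) * conj (matEntry e Ψ i (cartan t)) := fun i =>
    ((continuous_matEntry Φ i).comp continuous_cartan).mul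
      (Complex.continuous_conj.comp ((continuous_matEntry Ψ i).comp continuous_cartan))
  have hsum := continuous_finsetSum Finset.univ fun i _ => hq i
  -- The trace factors through `|g₃₃|²` by a function continuous on all of `ℝ`, to which the law
  -- applies.
  have htr : trMulAdj Φ Ψ = fun g : G => (fun t : ℝ => ∑ i,
      matEntry e Φ i (cartan t) * conj (matEntry e Ψ i (cartan t))) (‖mat g 2 2‖ ^ 2) := by
    ext g
    rw [trMulAdj_eq_cartan he hΦ hΨ, trMulAdj_cartan he hΦ hΨ]
  have hw : ∀ i, Set.EqOn (fun r : ℝ => _) _ (Set.Ioi 0) := fun i r (hr : 0 < r) =>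
    weight_mul_diagEntry_mul_conj hΦ hΨ i hr.le
  refine ⟨fun r _ g hg h0 h1 i => ⟨hΦ.quot_apply_vec hg h0 h1 i, hΨ.quot_apply_vec hg h0 h1 i⟩,
    ?_, fun i => ?_, ?_⟩
  · rw [htr]
    exact integrable_comp_norm_mat_sq μ hsum
  · exact (integrableOn_congr_fun (hw i) measurableSet_Ioi).2 (integrableOn_radial (hq i))
  · rw [htr, integral_comp_norm_mat_sq μ hsum, integral_radial]
    simp only [Finset.mul_sum]
    rw [integral_finsetSum _ fun i _ => integrableOn_radial (hq i), Finset.mul_sum]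
    exact Finset.sum_congr rfl fun i _ =>
      congrArg _ (setIntegral_congr_fun measurableSet_Ioi (hw i)).symm
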